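/- Let $\mathrm{Sym}(n)$ be the space of real symmetric $n\times n$ matrices and let $\mathrm{SPD}(n)\subset\mathrm{Sym}(n)$ be the open set of positive definite ones, a smooth manifold whose tangent spaces are canonically identified with $\mathrm{Sym}(n)$. For $\Sigma\in\mathrm{SPD}(n)$ and $X\in T_\Sigma\mathrm{SPD}(n)=\mathrm{Sym}(n)$ let $X^0\in\mathrm{Sym}(n)$ be the unique solution of $X=\Sigma X^0+X^0\Sigma$. The Bures-Wasserstein metric is the Riemannian metric $g_\Sigma(X,Y)=\frac12\mathrm{tr}(X^0Y)=\mathrm{tr}(X^0\Sigma Y^0)$ on $\mathrm{SPD}(n)$; equivalently $g_\Sigma(X,X)=\frac12\sum_{i,j}\frac{1}{d_i+d_j}[P^\top XP]_{ij}^2$ if $\Sigma=PDP^\top$ with $P\in\mathrm{O}(n)$ and $D=\mathrm{diag}(d_1,\dots,d_n)$. Its Levi-Civita connection $\nabla$ (the torsion-free connection compatible with $g$) exists and is given, for vector fields $X,Y$ on $\mathrm{SPD}(n)$ with $Y$ differentiable at $\Sigma$, by $$(\nabla_XY)_{|\Sigma}=(\partial_XY)_{|\Sigma}-(X^0\Sigma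 Y^0+Y^0\Sigma X^0),$$ where $\partial_XY$ is the derivative of the $\mathrm{Sym}(n)$-valued map $Y$ in the direction $X$ and $X^0,Y^0$ are computed at $\Sigma$. Let $R(X,Y)Z=\nabla_X\nabla_YZ-\nabla_Y\nabla_XZ-\nabla_{[X,Y]}Z$ be its curvature and $R(X,Y,Z,T)=g(R(X,Y)T,Z)$, so that the sectional curvature is $\kappa(X,Y)=\frac{R(X,Y,X,Y)}{g(X,X)g(Y,Y)-g(X,Y)^2}$ for linearly independent $X,Y$. For all smooth vector fields $X,Y$ on $\mathrm{SPD}(n)$, every $\Sigma\in\mathrm{SPD}(n)$ and every decomposition $\Sigma=PDP^\top$ with $P\in\mathrm{O}(n)$ and $D=\mathrm{diag}(d_1,\dots,d_n)$, $$R_\Sigma(X,Y,X,Y)=\frac32\sum_{i,j}\frac{d_id_j}{d_i+d_j}\left[{X^0}',{Y^0}'\right]_{ij}^2\;\geq\;0,$$ where ${X^0}'=P^\top X^0P$, ${Y^0}'=P^\top Y^0P$ and $[V,W]=VW-WV$. Hence the sectional curvature of the Bures-Wasserstein metric is non-negative. -/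

import Mathlib

open Bundle
open scoped Manifold ContDiff Matrix

noncomputable section

/-- Real symmetric `n × n` matrices, as a subspace of all matrices. -/
def symSubmodule (n : ℕ) : Submodule ℝ (Matrix (Fin n) (Fin n) ℝ) where
  carrier := {A | A.IsSymm}
  add_mem' := fun hA hB => hA.add hB
  zero_mem' := Matrix.isSymm_zero
  smul_mem' := fun c _ hA => hA.smul c

/-- The vector space `Sym(n)`. It is finite-dimensional and only its topology and smooth structure
matter, so it gets the (arbitrary) norm `max |A i j|`. -/
def SymMat (n : ℕ) : Type := symSubmodule n

section
attribute [local instance] Matrix.normedAddCommGroup Matrix.normedSpace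

instance symNormedAddCommGroup (n : ℕ) : NormedAddCommGroup (SymMat n) :=
  inferInstanceAs (NormedAddCommGroup (symSubmodule n))

instance symNormedSpace (n : ℕ) : NormedSpace ℝ (SymMat n) :=
  inferInstanceAs (NormedSpace ℝ (symSubmodule n))

instance symFiniteDimensional (n : ℕ) : FiniteDimensional ℝ (SymMat n) :=
  inferInstanceAs (FiniteDimensional ℝ (symSubmodule n))
end

/-- The inclusion of `Sym(n)` into the space of all matrices. -/
def SymMat.mat {n : ℕ} : SymMat n →ₗ[ℝ] Matrix (Fin n) (Fin n) ℝ := (symSubmodule n).subtype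

theorem SymMat.ext {n : ℕ} {A B : SymMat n} (h : A.mat = B.mat) : A = B := Subtype.ext h

theorem SymMat.transpose_mat {n : ℕ} (A : SymMat n) : A.matᵀ = A.mat := A.2

/-- A symmetric matrix as an element of `Sym(n)`. -/
def SymMat.mk {n : ℕ} (A : Matrix (Fin n) (Fin n) ℝ) (hA : Aᵀ = A) : SymMat n := ⟨A, hA⟩
theorem SymMat.mat_mk {n : ℕ} (A : Matrix (Fin n) (Fin n) ℝ) (hA : Aᵀ = A) :
    (SymMat.mk A hA).mat = A := rfl

theorem isOpen_posDef (n : ℕ) : IsOpen {S : SymMat n | S.mat.PosDef} := by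
  have key : {S : SymMat n | S.mat.PosDef} =
      {S : SymMat n | ∀ x ∈ Metric.sphere (0 : Fin n → ℝ) 1, 0 < x ⬝ᵥ (S.mat *ᵥ x)} := by
    ext S
    simp only [Set.mem_ofPred_eq]
    constructor
    · intro h x hx
      have hx0 : x ≠ 0 := by
        rintro rfl
        simp at hx
      simpa using h.dotProduct_mulVec_pos hx0
    · intro h
      refine Matrix.PosDef.of_dotProduct_mulVec_pos ?_ ?_
      · rw [Matrix.IsHermitian, Matrix.conjTranspose_eq_transpose_of_trivial]
        exact S.transpose_mat
      · intro x hx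
        have hn : 0 < ‖x‖ := norm_pos_iff.2 hx
        have := h (‖x‖⁻¹ • x) (by simp [norm_smul, hn.ne'])
        rw [Matrix.mulVec_smul, dotProduct_smul, smul_dotProduct, smul_eq_mul, smul_eq_mul] at this
        have h2 : 0 < ‖x‖⁻¹ := inv_pos.2 hn
        rw [mul_pos_iff_of_pos_left h2, mul_pos_iff_of_pos_left h2] at this
        simpa using this
  rw [key, isOpen_iff_eventually]
  intro S hS
  refine (isCompact_sphere (0 : Fin n → ℝ) 1).eventually_forall_of_forall_eventually ?_
  intro x hx
  have hm : Continuous (SymMat.mat : SymMat n → _) := SymMat.mat.continuous_of_finiteDimensional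
  have hc : Continuous fun p : SymMat n × (Fin n → ℝ) => p.2 ⬝ᵥ (p.1.mat *ᵥ p.2) := by fun_prop
  exact hc.continuousAt.eventually (lt_mem_nhds (hS x hx))

/-- `SPD(n)`: the symmetric positive definite matrices, an open subset of `Sym(n)`. As an open subset
it carries Mathlib's manifold structure, whose charts are all the inclusion into `Sym(n)`. -/
def SPD (n : ℕ) : TopologicalSpace.Opens (SymMat n) := ⟨_, isOpen_posDef n⟩

/-- The bilinear map `(Σ, Z) ↦ Σ Z + Z Σ` on `Sym(n)`. -/
def lyapunov (n : ℕ) : SymMat n →L[ℝ] SymMat n →L[ℝ] SymMat n :=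
  LinearMap.toContinuousBilinearMap <|
      LinearMap.mk₂ ℝ (fun S Z : SymMat n =>
        SymMat.mk (S.mat * Z.mat + Z.mat * S.mat) (by
          rw [Matrix.transpose_add, Matrix.transpose_mul, Matrix.transpose_mul, S.transpose_mat,
            Z.transpose_mat, add_comm]))
        (by intros; apply SymMat.ext; simp only [map_add, SymMat.mat_mk]; noncomm_ring)
        (by intros; apply SymMat.ext; simp [SymMat.mat_mk])
        (by intros; apply SymMat.ext; simp only [map_add, SymMat.mat_mk]; noncomm_ring)
        (by intros; apply SymMat.ext; simp [SymMat.mat_mk])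

theorem lyapunov_apply {n : ℕ} (S Z : SymMat n) :
    (lyapunov n S Z).mat = S.mat * Z.mat + Z.mat * S.mat := rfl

/-- `(X, Y) ↦ ½ tr(X Y)` on `Sym(n)`. -/
def traceForm (n : ℕ) : SymMat n →L[ℝ] SymMat n →L[ℝ] ℝ :=
  LinearMap.toContinuousBilinearMap <|
      LinearMap.mk₂ ℝ (fun X Y : SymMat n => (1 / 2 : ℝ) * (X.mat * Y.mat).trace)
        (by intros; simp [add_mul, mul_add]) (by intros; simp; ring)
        (by intros; simp [mul_add]) (by intros; simp; ring)


theorem trace_sandwich_pos {n : ℕ} {S Z : SymMat n} (hS : S.mat.PosDef) (hZ : Z ≠ 0) :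
    0 < (Z.mat * S.mat * Z.mat).trace := by
  have h3 : (Z.mat * S.mat * Z.mat).PosSemidef := by
    simpa [Matrix.conjTranspose_eq_transpose_of_trivial, Z.transpose_mat] using
      hS.posSemidef.conjTranspose_mul_mul_same Z.mat
  refine lt_of_le_of_ne h3.trace_nonneg fun h1 => hZ ?_
  have h4 := h3.trace_eq_zero_iff.1 h1.symm
  apply SymMat.ext
  rw [map_zero]
  ext i j
  have h5 : (Z.mat * S.mat * Z.mat) j j = 0 := by rw [h4]; rfl
  by_contra hne
  have hc : Z.mat.col j ≠ 0 := fun h => hne (congrFun h i)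
  have h6 := hS.dotProduct_mulVec_pos hc
  refine h6.ne' ?_
  rw [← h5]
  have hsym : ∀ a, Z.mat j a = Z.mat a j := fun a => congrFun (congrFun Z.transpose_mat a) j
  simp only [Matrix.mul_apply, Matrix.mulVec, dotProduct, Matrix.transpose_apply, Matrix.col,
    Finset.mul_sum, Finset.sum_mul, star_trivial, hsym]
  rw [Finset.sum_comm]
  refine Finset.sum_congr rfl fun a _ => Finset.sum_congr rfl fun b _ => ?_
  ring

theorem lyapunov_injective {n : ℕ} {S : SymMat n} (hS : S.mat.PosDef) :
    Function.Injective (lyapunov n S) := by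
  rw [injective_iff_map_eq_zero]
  intro Z hZ
  by_contra hne
  have h0 : S.mat * Z.mat + Z.mat * S.mat = 0 := by
    rw [← lyapunov_apply, hZ, map_zero]
  have h2 := congrArg (fun M => (Z.mat * M).trace) h0
  simp only [mul_add, Matrix.trace_add, mul_zero, Matrix.trace_zero] at h2
  rw [← Matrix.mul_assoc, ← Matrix.mul_assoc, Matrix.trace_mul_comm (Z.mat * Z.mat),
    ← Matrix.mul_assoc, Matrix.trace_mul_comm (S.mat * Z.mat), ← Matrix.mul_assoc] at h2
  linarith [trace_sandwich_pos hS hne]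

theorem lyapunov_isInvertible {n : ℕ} {S : SymMat n} (hS : S.mat.PosDef) :
    (lyapunov n S).IsInvertible :=
  ⟨(LinearEquiv.ofInjectiveEndo (lyapunov n S : SymMat n →ₗ[ℝ] SymMat n)
    (lyapunov_injective hS)).toContinuousLinearEquiv, by ext1 x; rfl⟩

/-- `X ↦ X⁰`, the solution of the Sylvester equation `X = Σ X⁰ + X⁰ Σ` for `Σ` positive definite
(see `symLift_spec`; the solution is unique by `lyapunov_injective`). -/
def symLift {n : ℕ} (S : SymMat n) : SymMat n →L[ℝ] SymMat n := (lyapunov n S).inverse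

theorem lyapunov_symLift {n : ℕ} {S : SymMat n} (hS : S.mat.PosDef) (X : SymMat n) :
    lyapunov n S (symLift S X) = X := by
  simpa [symLift] using (lyapunov_isInvertible hS).self_apply_inverse X

theorem symLift_spec {n : ℕ} {S : SymMat n} (hS : S.mat.PosDef) (X : SymMat n) :
    X.mat = S.mat * (symLift S X).mat + (symLift S X).mat * S.mat := by
  rw [← lyapunov_apply, lyapunov_symLift hS]

/-- The Bures-Wasserstein inner product at `Σ`, `g_Σ(X, Y) = ½ tr(X⁰ Y)`. -/
def bwForm {n : ℕ} (S : SymMat n) : SymMat n →L[ℝ] SymMat n →L[ℝ] ℝ :=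
  (traceForm n).comp (symLift S)

theorem bwForm_apply {n : ℕ} (S X Y : SymMat n) :
    bwForm S X Y = (1 / 2 : ℝ) * ((symLift S X).mat * Y.mat).trace := rfl

/-- `g_Σ(X, Y) = tr(X⁰ Σ Y⁰)`. -/
theorem bwForm_eq {n : ℕ} {S : SymMat n} (hS : S.mat.PosDef) (X Y : SymMat n) :
    bwForm S X Y = ((symLift S X).mat * S.mat * (symLift S Y).mat).trace := by
  rw [bwForm_apply]
  nth_rw 1 [symLift_spec hS Y]
  rw [mul_add, Matrix.trace_add]
  have : ((symLift S X).mat * ((symLift S Y).mat * S.mat)).trace =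
      ((symLift S X).mat * (S.mat * (symLift S Y).mat)).trace := by
    rw [← Matrix.trace_transpose]
    simp only [Matrix.transpose_mul, SymMat.transpose_mat]
    rw [Matrix.trace_mul_comm]
  rw [this, Matrix.mul_assoc]
  ring

theorem bwForm_symm {n : ℕ} {S : SymMat n} (hS : S.mat.PosDef) (X Y : SymMat n) :
    bwForm S X Y = bwForm S Y X := by
  rw [bwForm_eq hS, bwForm_eq hS, ← Matrix.trace_transpose]
  simp only [Matrix.transpose_mul, SymMat.transpose_mat, Matrix.mul_assoc]

theorem bwForm_pos {n : ℕ} {S : SymMat n} (hS : S.mat.PosDef) (X : SymMat n) (hX : X ≠ 0) :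
    0 < bwForm S X X := by
  rw [bwForm_eq hS]
  refine trace_sandwich_pos hS fun h => hX ?_
  rw [← lyapunov_symLift hS X, h, map_zero]

/-- `g_Σ(X, X) = ½ ∑ X'_ij² / (d_i + d_j)` where `Σ = P D Pᵀ` and `X' = Pᵀ X P`. -/
theorem bwForm_spectral {n : ℕ} {S X : SymMat n} (hS : S.mat.PosDef)
    {P : Matrix (Fin n) (Fin n) ℝ} (hP : P ∈ Matrix.orthogonalGroup (Fin n) ℝ) {d : Fin n → ℝ}
    (h : S.mat = P * Matrix.diagonal d * Pᵀ) :
    bwForm S X X = (1 / 2 : ℝ) * ∑ i, ∑ j, 1 / (d i + d j) * (Pᵀ * X.mat * P) i j ^ 2 := by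
  have hP1 : Pᵀ * P = 1 := (Matrix.mem_orthogonalGroup_iff' (Fin n) ℝ).1 hP
  have hP2 : P * Pᵀ = 1 := (Matrix.mem_orthogonalGroup_iff (Fin n) ℝ).1 hP
  have hD : Pᵀ * S.mat * P = Matrix.diagonal d := by
    rw [h]
    calc Pᵀ * (P * Matrix.diagonal d * Pᵀ) * P
        = (Pᵀ * P) * Matrix.diagonal d * (Pᵀ * P) := by simp only [Matrix.mul_assoc]
      _ = _ := by simp [hP1]
  have hd : ∀ i, 0 < d i := by
    have h1 : (Pᵀ * S.mat * P).PosDef := by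
      have hu : IsUnit P := ⟨⟨P, Pᵀ, hP2, hP1⟩, rfl⟩
      simpa [Matrix.star_eq_conjTranspose, Matrix.conjTranspose_eq_transpose_of_trivial] using
        (Matrix.IsUnit.posDef_star_left_conjugate_iff hu).2 hS
    rw [hD] at h1
    exact Matrix.posDef_diagonal_iff.1 h1
  set A := Pᵀ * (symLift S X).mat * P with hA
  have hAT : Aᵀ = A := by
    rw [hA]
    simp only [Matrix.transpose_mul, SymMat.transpose_mat, Matrix.transpose_transpose,
      Matrix.mul_assoc]
  have hX : Pᵀ * X.mat * P = Matrix.diagonal d * A + A * Matrix.diagonal d := by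
    conv_lhs => rw [symLift_spec hS X]
    rw [← hD, hA]
    calc _ = Pᵀ * S.mat * 1 * (symLift S X).mat * P + Pᵀ * (symLift S X).mat * 1 * S.mat * P := by
          simp only [Matrix.mul_one, Matrix.mul_add, Matrix.add_mul, Matrix.mul_assoc]
      _ = _ := by rw [← hP2]; simp only [Matrix.mul_assoc]
  have hij : ∀ i j, (Pᵀ * X.mat * P) i j = (d i + d j) * A i j := by
    intro i j
    rw [hX, Matrix.add_apply, Matrix.diagonal_mul, Matrix.mul_diagonal]
    ring
  have htr : (X.mat * (symLift S X).mat).trace = ((Pᵀ * X.mat * P) * A).trace := by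
    calc (X.mat * (symLift S X).mat).trace = (X.mat * (symLift S X).mat * (P * Pᵀ)).trace := by
          rw [hP2, mul_one]
      _ = (Pᵀ * (X.mat * 1 * (symLift S X).mat * P)).trace := by
          rw [← Matrix.mul_assoc, Matrix.trace_mul_comm, mul_one]
      _ = _ := by rw [← hP2, hA]; simp only [Matrix.mul_assoc]
  rw [bwForm_apply, Matrix.trace_mul_comm, htr, Matrix.trace]
  congr 1
  refine Finset.sum_congr rfl fun i _ => ?_
  rw [Matrix.diag_apply, Matrix.mul_apply]
  refine Finset.sum_congr rfl fun j _ => ?_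
  rw [hij, ← congrFun (congrFun hAT j) i, Matrix.transpose_apply]
  have := (add_pos (hd i) (hd j)).ne'
  field_simp

theorem contDiffAt_bwForm {n : ℕ} {S : SymMat n} (hS : S.mat.PosDef) :
    ContDiffAt ℝ ∞ (fun S : SymMat n => bwForm S) S := by
  have h1 : ContDiffAt ℝ ∞ (fun S : SymMat n => symLift S) S :=
    (lyapunov_isInvertible hS).contDiffAt_map_inverse.comp S (lyapunov n).contDiff.contDiffAt
  exact contDiffAt_const.clm_comp h1

theorem isVonNBounded_bwForm {n : ℕ} {S : SymMat n} (hS : S.mat.PosDef) :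
    Bornology.IsVonNBounded ℝ {v : SymMat n | bwForm S v v < 1} := by
  have hc : ContinuousOn (fun u : SymMat n => (bwForm S u u)⁻¹) (Metric.sphere 0 1) := by
    refine ContinuousOn.inv₀ (by fun_prop) fun u hu => (bwForm_pos hS u ?_).ne'
    rintro rfl
    simp at hu
  have : ProperSpace (SymMat n) := FiniteDimensional.proper ℝ _
  obtain ⟨C, hC⟩ := (isCompact_sphere (0 : SymMat n) 1).exists_bound_of_continuousOn hc
  refine (NormedSpace.isVonNBounded_closedBall ℝ (SymMat n) (1 + |C|)).subset fun v hv => ?_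
  rw [Set.mem_ofPred_eq] at hv
  rw [mem_closedBall_zero_iff]
  by_cases h0 : v = 0
  · rw [h0, norm_zero]
    positivity
  have hn : 0 < ‖v‖ := norm_pos_iff.2 h0
  have hu : ‖v‖⁻¹ • v ∈ Metric.sphere (0 : SymMat n) 1 := by simp [norm_smul, hn.ne']
  have h1 := (Real.norm_eq_abs _ ▸ le_abs_self _).trans (hC _ hu)
  have hq := bwForm_pos hS v h0
  simp only [map_smul, _root_.smul_apply, smul_eq_mul, mul_inv, inv_inv] at h1
  have h2 : ‖v‖ * ‖v‖ ≤ C * bwForm S v v := by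
    rw [← mul_assoc, ← div_eq_mul_inv, div_le_iff₀ hq] at h1
    exact h1
  have h3 : C * bwForm S v v ≤ |C| * 1 :=
    mul_le_mul (le_abs_self C) hv.le hq.le (abs_nonneg C)
  nlinarith [abs_nonneg C]


/-- All local trivializations of the tangent bundle of `SPD(n)` are the identity. -/
theorem spd_symmL {n : ℕ} (p q : SPD n) (v : SymMat n) :
    (trivializationAt (SymMat n) (TangentSpace 𝓘(ℝ, SymMat n)) p).symmL ℝ q v = v := by
  have hq : q ∈ (chartAt (SymMat n) p).source := mem_chart_source (SymMat n) q
  rw [TangentBundle.symmL_trivializationAt_eq_core hq]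
  exact tangentCoordChange_self (I := 𝓘(ℝ, SymMat n)) (x := q) (by simp)

theorem spd_symm {n : ℕ} (p q : SPD n) (v : SymMat n) :
    (trivializationAt (SymMat n) (TangentSpace 𝓘(ℝ, SymMat n)) p).symm q v = v := by
  have h := spd_symmL p q v
  rwa [Bundle.Trivialization.symmL_apply _ (mem_chart_source (SymMat n) q)] at h

/-- The Bures-Wasserstein inner product on the tangent space of `SPD(n)` at `p`. -/
def bwInner {n : ℕ} (p : SPD n) :
    TangentSpace 𝓘(ℝ, SymMat n) p →L[ℝ] TangentSpace 𝓘(ℝ, SymMat n) p →L[ℝ] ℝ :=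
  bwForm (p : SymMat n)

theorem contMDiff_bwInner (n : ℕ) :
    ContMDiff 𝓘(ℝ, SymMat n) (𝓘(ℝ, SymMat n).prod 𝓘(ℝ, SymMat n →L[ℝ] SymMat n →L[ℝ] ℝ)) ∞
      (fun p : SPD n => TotalSpace.mk' (SymMat n →L[ℝ] SymMat n →L[ℝ] ℝ)
        (E := fun p : SPD n => (TangentSpace 𝓘(ℝ, SymMat n) p →L[ℝ]
          TangentSpace 𝓘(ℝ, SymMat n) p →L[ℝ] ℝ)) p (bwInner p)) := by
    intro p
    rw [contMDiffAt_section]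
    have h : ContMDiffAt 𝓘(ℝ, SymMat n) 𝓘(ℝ, SymMat n →L[ℝ] SymMat n →L[ℝ] ℝ) ∞
        (fun q : SPD n => bwForm (q : SymMat n)) p :=
      (contDiffAt_bwForm p.2).contMDiffAt.comp p contMDiff_subtype_val.contMDiffAt
    convert! h using 2
    rename_i q
    ext v w
    have hx : ∀ x : SPD n, x ∈ (chartAt (SymMat n) p).source := fun x =>
      mem_chart_source (SymMat n) x
    rw [hom_trivializationAt_apply]
    erw [inCoordinates_apply_eq₂ (hx q) (hx q) (by trivial)]
    simp only [bwInner, spd_symm]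
    simp
    rfl

/-- The Bures-Wasserstein metric, as a smooth Riemannian metric on the manifold `SPD(n)`. -/
def bwMetric (n : ℕ) :
    ContMDiffRiemannianMetric 𝓘(ℝ, SymMat n) ∞ (SymMat n)
      (fun p : SPD n => TangentSpace 𝓘(ℝ, SymMat n) p) where
  inner p := bwInner p
  symm p v w := bwForm_symm p.2 v w
  pos p v hv := bwForm_pos p.2 v hv
  isVonNBounded p := isVonNBounded_bwForm p.2
  contMDiff := contMDiff_bwInner n

/-- The tangent spaces of `SPD(n)` carry the Bures-Wasserstein inner product. -/
instance spdRiemannianBundle (n : ℕ) :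
    RiemannianBundle (fun p : SPD n => TangentSpace 𝓘(ℝ, SymMat n) p) :=
  ⟨(bwMetric n).toRiemannianMetric⟩


/-- The canonical identification of the tangent space of `SPD(n)` at `p` with `Sym(n)`, that is, the
differential of the inclusion (see `mfderiv_val_eq_toSym`). -/
def toSym {n : ℕ} {p : SPD n} (v : TangentSpace 𝓘(ℝ, SymMat n) p) : SymMat n := v

theorem mfderiv_val_eq_toSym {n : ℕ} (p : SPD n) (v : TangentSpace 𝓘(ℝ, SymMat n) p) :
    mfderiv 𝓘(ℝ, SymMat n) 𝓘(ℝ, SymMat n) (fun q : SPD n => (q : SymMat n)) p v = toSym v := by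
  have hd : MDifferentiableAt 𝓘(ℝ, SymMat n) 𝓘(ℝ, SymMat n)
      (fun q : SPD n => (q : SymMat n)) p :=
    (contMDiff_subtype_val (I := 𝓘(ℝ, SymMat n)) (n := 1)).mdifferentiableAt one_ne_zero
  rw [hd.mfderiv]
  have h : writtenInExtChartAt 𝓘(ℝ, SymMat n) 𝓘(ℝ, SymMat n) p
      (fun q : SPD n => (q : SymMat n)) =ᶠ[nhds (p : SymMat n)] id := by
    have h1 := TopologicalSpace.Opens.chartAt_subtype_val_symm_eventuallyEq (H := SymMat n)
      (SPD n) (x := p)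
    filter_upwards [h1] with S hS
    exact hS.symm
  rw [ModelWithCorners.range_eq_univ, fderivWithin_univ]
  exact congrArg (fun L : SymMat n →L[ℝ] SymMat n => L v) (h.fderiv_eq.trans fderiv_id)

/-- Affine connections on `SPD(n)`. On paper `cov Y p (X p)` is `(∇_X Y)` at `p`. -/
abbrev SPDConnection (n : ℕ) : Type :=
  CovariantDerivative 𝓘(ℝ, SymMat n) (SymMat n)
    (fun p : SPD n => TangentSpace 𝓘(ℝ, SymMat n) p)

/-- Vector fields on `SPD(n)`, without any regularity. -/
abbrev SPDField (n : ℕ) : Type := (p : SPD n) → TangentSpace 𝓘(ℝ, SymMat n) p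

/-- Levi-Civita connection of the Bures-Wasserstein metric: torsion-free and metric. -/
def IsLeviCivita {n : ℕ} (cov : SPDConnection n) : Prop :=
  cov.torsion = 0 ∧ cov.IsMetricCompatible

/-- `(∂_X Y)` at `p`: the derivative of the `Sym(n)`-valued function `Y` in the direction `X p`. -/
def flatDeriv {n : ℕ} (X Y : SPDField n) (p : SPD n) : SymMat n :=
  mvfderiv 𝓘(ℝ, SymMat n) (fun q : SPD n => toSym (Y q)) p (X p)

/-- `R(X, Y) Z = ∇_X ∇_Y Z - ∇_Y ∇_X Z - ∇_[X, Y] Z`. -/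
def curvature {n : ℕ} (cov : SPDConnection n) (X Y Z : SPDField n) : SPDField n := fun p =>
  cov (fun q => cov Z q (Y q)) p (X p) - cov (fun q => cov Z q (X q)) p (Y p) -
    cov Z p (VectorField.mlieBracket 𝓘(ℝ, SymMat n) X Y p)

/-- `R(X, Y, Z, T) = g(R(X, Y) T, Z)`. With this order of the arguments the sectional curvature is
`R(X, Y, X, Y) / (g(X, X) g(Y, Y) - g(X, Y)²)`. -/
def riemann {n : ℕ} (cov : SPDConnection n) (X Y Z T : SPDField n) (p : SPD n) : ℝ :=
  bwInner p (curvature cov X Y T p) (Z p)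


/-- The vector field `X` is differentiable at `p`. -/
def MDiffFieldAt {n : ℕ} (X : SPDField n) (p : SPD n) : Prop :=
  MDifferentiableAt 𝓘(ℝ, SymMat n) (𝓘(ℝ, SymMat n).prod 𝓘(ℝ, SymMat n))
    (fun q => (⟨q, X q⟩ : TangentBundle 𝓘(ℝ, SymMat n) (SPD n))) p
/-- The vector field `X` is smooth on `SPD(n)`. -/
def SmoothField {n : ℕ} (X : SPDField n) : Prop :=
  ContMDiff 𝓘(ℝ, SymMat n) (𝓘(ℝ, SymMat n).prod 𝓘(ℝ, SymMat n)) ∞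
    (fun q => (⟨q, X q⟩ : TangentBundle 𝓘(ℝ, SymMat n) (SPD n)))

/-- The matrix `X⁰` of a tangent vector `X` of `SPD(n)` at `Σ = p`: `X = Σ X⁰ + X⁰ Σ`. -/
def lift0 {n : ℕ} {p : SPD n} (v : TangentSpace 𝓘(ℝ, SymMat n) p) : Matrix (Fin n) (Fin n) ℝ :=
  (symLift (p : SymMat n) (toSym v)).mat

theorem lift0_spec {n : ℕ} {p : SPD n} (v : TangentSpace 𝓘(ℝ, SymMat n) p) :
    (toSym v).mat = p.1.mat * lift0 v + lift0 v * p.1.mat :=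
  symLift_spec p.2 (toSym v)

/-- The sectional curvature of the plane spanned by `X p` and `Y p`. -/
def sectionalCurvature {n : ℕ} (cov : SPDConnection n) (X Y : SPDField n) (p : SPD n) : ℝ :=
  riemann cov X Y X Y p / (bwInner p (X p) (X p) * bwInner p (Y p) (Y p) - bwInner p (X p) (Y p) ^ 2)

end

/-! `SPD n` is open in `SymMat n`, so vector fields are locally matrix-valued functions, and a
connection is the flat derivative minus a Christoffel form; here Γ(X, Y) = X⁰ΣY⁰ + Y⁰ΣX⁰. Symmetry
of Γ is vanishing torsion. Differentiating X = ΣX⁰ + X⁰Σ gives the derivative of g, which two Γ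
terms compensate (`bwForm_christoffel_add`): this is metric compatibility. Any other Levi-Civita
connection differs from this one by a tensor with a symmetric and a skew pair of slots, which is
zero (`eq_zero_of_symm_of_skew`).

The curvature R(X, Y)Y is then an expression in Γ and ∂Γ. It involves the solutions of several
Sylvester equations, which are not polynomial in Σ, x = X⁰ and y = Y⁰. All of them cancel but one,
the matrix r with Σr + rΣ = CΣ - ΣC, where C = [x, y] (`mat_christoffelCurvature`). Pairing with X
and using cyclicity of the trace leaves -(3/4) tr(ΣC²) - (3/8) tr(r(CΣ - ΣC))
(`bwForm_christoffelCurvature`).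

In an eigenbasis of Σ, r_ij = (d_j - d_i)/(d_i + d_j) C_ij. As C is skew, the coefficient of C_ij²
becomes (3/8)((d_i + d_j) - (d_j - d_i)²/(d_i + d_j)) = (3/2) d_i d_j/(d_i + d_j), which is positive
(`trace_diagonal_formula`). -/

open Filter Topology

/-! ### Calculus on the manifold reduced to calculus in the vector space. -/

section Transfer

variable {n : ℕ} {F : Type*} [NormedAddCommGroup F]

/-- Extension by zero of a function on `SPD(n)` to all of `Sym(n)`. -/
noncomputable def flatExtend (f : SPD n → F) : SymMat n → F := Function.extend Subtype.val f 0

theorem flatExtend_coe (f : SPD n → F) (p : SPD n) : flatExtend f p = f p :=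
  Subtype.val_injective.extend_apply f 0 p

theorem eventually_mem_SPD (p : SPD n) : ∀ᶠ S in 𝓝 (p : SymMat n), S ∈ SPD n :=
  (SPD n).isOpen.mem_nhds p.2

/-- Openness of `SPD n` makes the germ at `p` independent of the default value 0 outside. -/
theorem flatExtend_eventuallyEq (f : SPD n → F) {g : SymMat n → F} (h : ∀ q : SPD n, f q = g q)
    (p : SPD n) : flatExtend f =ᶠ[𝓝 (p : SymMat n)] g := by
  filter_upwards [eventually_mem_SPD p] with S hS
  exact (flatExtend_coe f ⟨S, hS⟩).trans (h ⟨S, hS⟩)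

theorem flatExtend_eventuallyEq_chart (f : SPD n → F) (p : SPD n) :
    flatExtend f =ᶠ[𝓝 (p : SymMat n)] f ∘ (chartAt (SymMat n) p).symm := by
  filter_upwards [TopologicalSpace.Opens.chartAt_subtype_val_symm_eventuallyEq (H := SymMat n)
    (SPD n) (x := p)] with S hS
  have hS' : (((chartAt (SymMat n) p).symm S : SPD n) : SymMat n) = S := hS.symm
  rw [Function.comp_apply, ← flatExtend_coe f, hS']

variable [NormedSpace ℝ F]

theorem contMDiffAt_iff_flatExtend {k : ℕ∞ω} (f : SPD n → F) (p : SPD n) :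
    ContMDiffAt 𝓘(ℝ, SymMat n) 𝓘(ℝ, F) k f p ↔ ContDiffAt ℝ k (flatExtend f) p := by
  constructor
  · intro h
    have hc : ContMDiffAt 𝓘(ℝ, SymMat n) 𝓘(ℝ, SymMat n) k (chartAt (SymMat n) p).symm
        (p : SymMat n) := by
      refine contMDiffOn_chart_symm.contMDiffAt ?_
      exact (chartAt (SymMat n) p).open_target.mem_nhds
        ((chartAt (SymMat n) p).map_source (mem_chart_source _ p))
    have hp : (chartAt (SymMat n) p).symm (p : SymMat n) = p :=
      (chartAt (SymMat n) p).left_inv (mem_chart_source _ p)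
    have h2 : ContMDiffAt 𝓘(ℝ, SymMat n) 𝓘(ℝ, F) k f ((chartAt (SymMat n) p).symm p) := by
      rwa [hp]
    exact (h2.comp (p : SymMat n) hc).contDiffAt.congr_of_eventuallyEq
      (flatExtend_eventuallyEq_chart f p)
  · intro h
    have := h.contMDiffAt.comp p (contMDiff_subtype_val (I := 𝓘(ℝ, SymMat n)) (n := k)).contMDiffAt
    exact this.congr_of_eventuallyEq (Eventually.of_forall fun q => (flatExtend_coe f q).symm)

theorem mdifferentiableAt_iff_flatExtend (f : SPD n → F) (p : SPD n) :
    MDifferentiableAt 𝓘(ℝ, SymMat n) 𝓘(ℝ, F) f p ↔ DifferentiableAt ℝ (flatExtend f) p := by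
  constructor
  · intro h
    have hc : MDifferentiableAt 𝓘(ℝ, SymMat n) 𝓘(ℝ, SymMat n) (chartAt (SymMat n) p).symm
        (p : SymMat n) := by
      refine mdifferentiableAt_atlas_symm (chart_mem_atlas _ p)
        ((chartAt (SymMat n) p).map_source (mem_chart_source _ p))
    have hp : (chartAt (SymMat n) p).symm (p : SymMat n) = p :=
      (chartAt (SymMat n) p).left_inv (mem_chart_source _ p)
    have h2 : MDifferentiableAt 𝓘(ℝ, SymMat n) 𝓘(ℝ, F) f ((chartAt (SymMat n) p).symm p) := by
      rwa [hp]
    exact (h2.comp (p : SymMat n) hc).differentiableAt.congr_of_eventuallyEq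
      (flatExtend_eventuallyEq_chart f p)
  · intro h
    have := h.mdifferentiableAt.comp p
      ((contMDiff_subtype_val (I := 𝓘(ℝ, SymMat n)) (n := 1)).mdifferentiableAt one_ne_zero)
    exact this.congr_of_eventuallyEq (Eventually.of_forall fun q => (flatExtend_coe f q).symm)

theorem mvfderiv_eq_fderiv_flatExtend (f : SPD n → F) (p : SPD n)
    (v : TangentSpace 𝓘(ℝ, SymMat n) p) :
    mvfderiv 𝓘(ℝ, SymMat n) f p v = fderiv ℝ (flatExtend f) p (toSym v) := by
  by_cases hd : MDifferentiableAt 𝓘(ℝ, SymMat n) 𝓘(ℝ, F) f p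
  · rw [mvfderiv, hd.mfderiv, ModelWithCorners.range_eq_univ, fderivWithin_univ]
    exact congrArg (fun L : SymMat n →L[ℝ] F => L v)
      (flatExtend_eventuallyEq_chart f p).fderiv_eq.symm
  -- Without differentiability both derivatives take the default value 0.
  · rw [mvfderiv, mfderiv_zero_of_not_mdifferentiableAt hd, fderiv_zero_of_not_differentiableAt
      (fun h => hd ((mdifferentiableAt_iff_flatExtend f p).2 h))]
    rfl

theorem trivializationAt_snd (p q : SPD n) (v : TangentSpace 𝓘(ℝ, SymMat n) q) :
    (trivializationAt (SymMat n) (TangentSpace 𝓘(ℝ, SymMat n)) p ⟨q, v⟩).2 = toSym v := by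
  exact tangentCoordChange_self (I := 𝓘(ℝ, SymMat n)) (x := q) (by simp)

/-- A vector field as a function `Sym(n) → Sym(n)`. -/
noncomputable def flatField (X : SPDField n) : SymMat n → SymMat n :=
  flatExtend fun q => toSym (X q)

theorem flatField_coe (X : SPDField n) (p : SPD n) : flatField X p = toSym (X p) :=
  flatExtend_coe _ p

theorem trivializationAt_section (X : SPDField n) (p : SPD n) :
    (fun q => (trivializationAt (SymMat n) (TangentSpace 𝓘(ℝ, SymMat n)) p ⟨q, X q⟩).2) =
      fun q => toSym (X q) :=
  funext fun q => trivializationAt_snd p q (X q)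

theorem mDiffFieldAt_iff (X : SPDField n) (p : SPD n) :
    MDiffFieldAt X p ↔ DifferentiableAt ℝ (flatField X) p := by
  rw [MDiffFieldAt, mdifferentiableAt_section, flatField, ← mdifferentiableAt_iff_flatExtend]
  exact iff_of_eq (congrArg (fun f : SPD n → SymMat n =>
    MDifferentiableAt 𝓘(ℝ, SymMat n) 𝓘(ℝ, SymMat n) f p) (trivializationAt_section X p))

theorem SmoothField.contDiffAt {X : SPDField n} (h : SmoothField X) (p : SPD n) :
    ContDiffAt ℝ ∞ (flatField X) p := by
  rw [flatField, ← contMDiffAt_iff_flatExtend, ← trivializationAt_section X p]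
  exact (contMDiffAt_section _).1 (h p)

theorem flatDeriv_eq (X Y : SPDField n) (p : SPD n) :
    flatDeriv X Y p = fderiv ℝ (flatField Y) p (toSym (X p)) :=
  mvfderiv_eq_fderiv_flatExtend _ p _

theorem mfderiv_val (p : SPD n) :
    mfderiv 𝓘(ℝ, SymMat n) 𝓘(ℝ, SymMat n) (fun q : SPD n => (q : SymMat n)) p =
      ContinuousLinearMap.id ℝ (SymMat n) := by
  ext1 v
  exact mfderiv_val_eq_toSym p v

/-- A map `Sym(n) → Sym(n)` as a vector field on the manifold `Sym(n)`. -/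
def symField (V : SymMat n → SymMat n) : (S : SymMat n) → TangentSpace 𝓘(ℝ, SymMat n) S := V

theorem mpullback_val (V : (S : SymMat n) → TangentSpace 𝓘(ℝ, SymMat n) S) (p : SPD n) :
    VectorField.mpullback 𝓘(ℝ, SymMat n) 𝓘(ℝ, SymMat n) (fun q : SPD n => (q : SymMat n)) V p =
      V p := by
  rw [VectorField.mpullback_apply, mfderiv_val]
  exact congrArg (fun L : SymMat n →L[ℝ] SymMat n => L (V p)) ContinuousLinearMap.inverse_id

theorem mdifferentiableAt_symField {V : SymMat n → SymMat n} {S : SymMat n}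
    (h : DifferentiableAt ℝ V S) :
    MDifferentiableAt 𝓘(ℝ, SymMat n) (𝓘(ℝ, SymMat n).prod 𝓘(ℝ, SymMat n))
      (fun S => (⟨S, symField V S⟩ : TangentBundle 𝓘(ℝ, SymMat n) (SymMat n))) S := by
  rw [mdifferentiableAt_section]
  simp only [trivializationAt_model_space_apply]
  exact h.mdifferentiableAt

/-- The bracket is natural under pullback along the inclusion, whose differential is the identity.
-/
theorem mlieBracket_eq {X Y : SPDField n} {p : SPD n} (hX : MDiffFieldAt X p)
    (hY : MDiffFieldAt Y p) :
    toSym (VectorField.mlieBracket 𝓘(ℝ, SymMat n) X Y p) =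
      fderiv ℝ (flatField Y) p (toSym (X p)) - fderiv ℝ (flatField X) p (toSym (Y p)) := by
  rw [mDiffFieldAt_iff] at hX hY
  have hpull : ∀ Z : SPDField n, VectorField.mpullback 𝓘(ℝ, SymMat n) 𝓘(ℝ, SymMat n)
      (fun q : SPD n => (q : SymMat n)) (symField (flatField Z)) = Z := fun Z => by
    funext q
    exact (mpullback_val _ q).trans (flatField_coe Z q)
  have h := VectorField.mpullback_mlieBracket (I := 𝓘(ℝ, SymMat n)) (I' := 𝓘(ℝ, SymMat n))
    (f := fun q : SPD n => (q : SymMat n)) (x₀ := p) (n := 2) (mdifferentiableAt_symField hX)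
    (mdifferentiableAt_symField hY) contMDiff_subtype_val.contMDiffAt (by simp)
  rw [hpull, hpull] at h
  rw [← h, ← flatField_coe X, ← flatField_coe Y]
  refine (mpullback_val _ p).trans ?_
  rw [← VectorField.mlieBracketWithin_univ, VectorField.mlieBracketWithin_eq_lieBracketWithin]
  exact congrFun (VectorField.lieBracketWithin_univ (𝕜 := ℝ) (V := flatField X)
    (W := flatField Y)) (p : SymMat n)

end Transfer

/-! ### Derivatives of X⁰, of the Christoffel form and of the metric. -/

section Calculus

variable {n : ℕ} {S : SymMat n}

theorem lyapunov_comm (A B : SymMat n) : lyapunov n A B = lyapunov n B A :=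
  SymMat.ext (by rw [lyapunov_apply, lyapunov_apply, add_comm])

theorem symLift_lyapunov (hS : S.mat.PosDef) (Z : SymMat n) : symLift S (lyapunov n S Z) = Z :=
  lyapunov_injective hS (lyapunov_symLift hS _)

theorem symLift_eq_iff (hS : S.mat.PosDef) {X Z : SymMat n} :
    symLift S X = Z ↔ X = lyapunov n S Z :=
  ⟨fun h => by rw [← h, lyapunov_symLift hS], fun h => by rw [h, symLift_lyapunov hS]⟩

theorem contDiffAt_symLift (hS : S.mat.PosDef) {k : ℕ∞ω} :
    ContDiffAt ℝ k (fun T : SymMat n => symLift T) S :=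
  (lyapunov_isInvertible hS).contDiffAt_map_inverse.comp S (lyapunov n).contDiff.contDiffAt

theorem DifferentiableAt.symLift (hS : S.mat.PosDef) {u : SymMat n → SymMat n}
    (hu : DifferentiableAt ℝ u S) : DifferentiableAt ℝ (fun T => symLift T (u T)) S :=
  ((contDiffAt_symLift hS (k := 1)).differentiableAt one_ne_zero).clm_apply hu

theorem fderiv_lyapunov {u v : SymMat n → SymMat n} (hu : DifferentiableAt ℝ u S)
    (hv : DifferentiableAt ℝ v S) (H : SymMat n) :
    fderiv ℝ (fun T => lyapunov n (u T) (v T)) S H =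
      lyapunov n (fderiv ℝ u S H) (v S) + lyapunov n (u S) (fderiv ℝ v S H) := by
  rw [((lyapunov n).hasFDerivAt_of_bilinear hu.hasFDerivAt hv.hasFDerivAt).fderiv]
  simp [add_comm]

/-- Implicit differentiation: with w(T) = `symLift T (u T)`, the equation Tw + wT = u gives Hw + wH
+ Sw' + w'S = u'. -/
theorem fderiv_symLift (hS : S.mat.PosDef) {u : SymMat n → SymMat n}
    (hu : DifferentiableAt ℝ u S) (H : SymMat n) :
    fderiv ℝ (fun T => symLift T (u T)) S H =
      symLift S (fderiv ℝ u S H) - symLift S (lyapunov n H (symLift S (u S))) := by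
  have hw := hu.symLift hS
  have h1 : (fun T => lyapunov n T (symLift T (u T))) =ᶠ[𝓝 S] u := by
    filter_upwards [(isOpen_posDef n).mem_nhds hS] with T hT
    exact lyapunov_symLift hT _
  have h2 := congrArg (fun L : SymMat n →L[ℝ] SymMat n => L H) h1.fderiv_eq
  rw [fderiv_lyapunov differentiableAt_fun_id hw] at h2
  rw [← map_sub, eq_comm, symLift_eq_iff hS, ← h2]
  simp

/-- The Christoffel form `(X, Y) ↦ X⁰ Σ Y⁰ + Y⁰ Σ X⁰` (see `christoffel_mat`), expressed through
the Jordan product `A B + B A`. -/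
noncomputable def christoffel (S : SymMat n) : SymMat n →L[ℝ] SymMat n →L[ℝ] SymMat n :=
  LinearMap.toContinuousBilinearMap <|
    LinearMap.mk₂ ℝ (fun X Y : SymMat n => (1 / 2 : ℝ) • (lyapunov n X (symLift S Y) +
        lyapunov n Y (symLift S X) - lyapunov n S (lyapunov n (symLift S X) (symLift S Y))))
      (by intros; simp only [map_add, _root_.add_apply]; module)
      (by intros; simp only [map_smul, _root_.smul_apply]; module)
      (by intros; simp only [map_add, _root_.add_apply]; module)
      (by intros; simp only [map_smul, _root_.smul_apply]; module)

theorem christoffel_apply (S X Y : SymMat n) :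
    christoffel S X Y = (1 / 2 : ℝ) • (lyapunov n X (symLift S Y) +
      lyapunov n Y (symLift S X) - lyapunov n S (lyapunov n (symLift S X) (symLift S Y))) := rfl

theorem christoffel_comm (S X Y : SymMat n) : christoffel S X Y = christoffel S Y X := by
  rw [christoffel_apply, christoffel_apply, lyapunov_comm (symLift S X)]
  abel_nf

/-- With {a, b} = ab + ba, the Jordan identity is 2(xsy + ysx) = {{s, x}, y} + {{s, y}, x} - {s, {x,
y}}. Its right side never leaves Sym(n), so the bilinear product rule differentiates it. -/
theorem christoffel_mat (hS : S.mat.PosDef) (X Y : SymMat n) :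
    (christoffel S X Y).mat = (symLift S X).mat * S.mat * (symLift S Y).mat +
      (symLift S Y).mat * S.mat * (symLift S X).mat := by
  rw [christoffel_apply]
  simp only [map_smul, map_add, map_sub, lyapunov_apply]
  nth_rw 1 2 [symLift_spec hS X, symLift_spec hS Y]
  generalize S.mat = s, (symLift S X).mat = x, (symLift S Y).mat = y
  have : ∀ A : Matrix (Fin n) (Fin n) ℝ, (1 / 2 : ℝ) • (2 • A) = A := fun A => by module
  rw [← this (x * s * y + y * s * x)]
  congr 1
  noncomm_ring

/-- The derivative of the Christoffel form in the direction `H`. -/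
noncomputable def christoffelDeriv (S H X Y : SymMat n) : SymMat n :=
  -(1 / 2 : ℝ) • (lyapunov n X (symLift S (lyapunov n H (symLift S Y))) +
    lyapunov n Y (symLift S (lyapunov n H (symLift S X))) +
    lyapunov n H (lyapunov n (symLift S X) (symLift S Y)) -
    lyapunov n S (lyapunov n (symLift S (lyapunov n H (symLift S X))) (symLift S Y)) -
    lyapunov n S (lyapunov n (symLift S X) (symLift S (lyapunov n H (symLift S Y)))))

theorem differentiableAt_lyapunov {u v : SymMat n → SymMat n} (hu : DifferentiableAt ℝ u S)
    (hv : DifferentiableAt ℝ v S) : DifferentiableAt ℝ (fun T => lyapunov n (u T) (v T)) S :=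
  ((lyapunov n).differentiableAt.comp S hu).clm_apply hv

theorem differentiableAt_christoffel (hS : S.mat.PosDef) {u v : SymMat n → SymMat n}
    (hu : DifferentiableAt ℝ u S) (hv : DifferentiableAt ℝ v S) :
    DifferentiableAt ℝ (fun T => christoffel T (u T) (v T)) S := by
  simp only [christoffel_apply]
  exact (((differentiableAt_lyapunov hu (hv.symLift hS)).add
    (differentiableAt_lyapunov hv (hu.symLift hS))).sub (differentiableAt_lyapunov
      differentiableAt_fun_id (differentiableAt_lyapunov (hu.symLift hS) (hv.symLift hS)))).const_smul (1 / 2 : ℝ)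

theorem fderiv_christoffel (hS : S.mat.PosDef) {u v : SymMat n → SymMat n}
    (hu : DifferentiableAt ℝ u S) (hv : DifferentiableAt ℝ v S) (H : SymMat n) :
    fderiv ℝ (fun T => christoffel T (u T) (v T)) S H =
      christoffelDeriv S H (u S) (v S) + christoffel S (fderiv ℝ u S H) (v S) +
        christoffel S (u S) (fderiv ℝ v S H) := by
  have hu' := hu.symLift hS
  have hv' := hv.symLift hS
  have h1 := differentiableAt_lyapunov hu hv'
  have h2 := differentiableAt_lyapunov hv hu'
  have h3 := differentiableAt_lyapunov hu' hv'
  have h4 := differentiableAt_lyapunov differentiableAt_fun_id h3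
  simp only [christoffel_apply]
  rw [fderiv_fun_const_smul ((h1.fun_add h2).fun_sub h4) (1 / 2 : ℝ), fderiv_fun_sub (h1.fun_add h2) h4,
    fderiv_fun_add h1 h2]
  simp only [_root_.smul_apply, _root_.sub_apply, _root_.add_apply]
  rw [fderiv_lyapunov hu hv', fderiv_lyapunov hv hu', fderiv_lyapunov differentiableAt_fun_id h3,
    fderiv_lyapunov hu' hv', fderiv_symLift hS hu, fderiv_symLift hS hv, christoffelDeriv]
  simp only [fderiv_fun_id, ContinuousLinearMap.id_apply, map_add, map_sub, _root_.sub_apply]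
  module

/-- With U and V held fixed, the derivative of g in the direction H is minus the right side, so this
is metric compatibility for constant fields. Once H is replaced by sh + hs, both sides are the same
four trace words up to cyclic permutation. -/
theorem bwForm_christoffel_add (hS : S.mat.PosDef) (H U V : SymMat n) :
    bwForm S (christoffel S H U) V + bwForm S U (christoffel S H V) =
      traceForm n (symLift S (lyapunov n H (symLift S U))) V := by
  change _ = bwForm S (lyapunov n H (symLift S U)) V
  rw [bwForm_symm hS _ V, bwForm_symm hS _ V]
  simp only [bwForm_apply, christoffel_mat hS, lyapunov_apply]
  nth_rw 1 2 [symLift_spec hS H]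
  generalize S.mat = s, (symLift S H).mat = h, (symLift S U).mat = u, (symLift S V).mat = v
  have h1 : (u * h * s * v).trace = (v * u * h * s).trace := by
    rw [Matrix.trace_mul_comm]; simp only [Matrix.mul_assoc]
  have h2 : (u * v * s * h).trace = (v * s * h * u).trace := by
    rw [Matrix.mul_assoc, Matrix.mul_assoc, Matrix.trace_mul_comm]; simp only [Matrix.mul_assoc]
  simp only [mul_add, add_mul, Matrix.trace_add, ← Matrix.mul_assoc, h1, h2]
  ring

theorem fderiv_bwForm (hS : S.mat.PosDef) {u v : SymMat n → SymMat n}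
    (hu : DifferentiableAt ℝ u S) (hv : DifferentiableAt ℝ v S) (H : SymMat n) :
    fderiv ℝ (fun T => bwForm T (u T) (v T)) S H =
      bwForm S (fderiv ℝ u S H - christoffel S H (u S)) (v S) +
        bwForm S (u S) (fderiv ℝ v S H - christoffel S H (v S)) := by
  have h := (traceForm n).hasFDerivAt_of_bilinear (hu.symLift hS).hasFDerivAt hv.hasFDerivAt
  have h' : fderiv ℝ (fun T => bwForm T (u T) (v T)) S H =
      traceForm n (symLift S (u S)) (fderiv ℝ v S H) +
        traceForm n (fderiv ℝ (fun T => symLift T (u T)) S H) (v S) :=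
    congrArg (fun L : SymMat n →L[ℝ] ℝ => L H) h.fderiv
  refine h'.trans ?_
  have h3 := bwForm_christoffel_add hS H (u S) (v S)
  simp only [fderiv_symLift hS hu, map_sub, _root_.sub_apply]
  rw [← h3]
  simp only [bwForm, ContinuousLinearMap.comp_apply]
  ring

end Calculus

/-! ### Existence and uniqueness of the Levi-Civita connection. -/

section LeviCivita

variable {n : ℕ}

theorem fderiv_flatField_add {X Y : SPDField n} {p : SPD n} (hX : MDiffFieldAt X p)
    (hY : MDiffFieldAt Y p) : fderiv ℝ (flatField (X + Y)) p =
      fderiv ℝ (flatField X) p + fderiv ℝ (flatField Y) p := by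
  rw [mDiffFieldAt_iff] at hX hY
  rw [← fderiv_add hX hY]
  refine (flatExtend_eventuallyEq _ (fun q => ?_) p).fderiv_eq
  change _ = flatField X q + flatField Y q
  rw [flatField_coe, flatField_coe]
  rfl

theorem fderiv_flatField_smul {g : SPD n → ℝ} {X : SPDField n} {p : SPD n}
    (hX : MDiffFieldAt X p) (hg : MDifferentiableAt 𝓘(ℝ, SymMat n) 𝓘(ℝ, ℝ) g p) :
    fderiv ℝ (flatField (g • X)) p =
      g p • fderiv ℝ (flatField X) p + (fderiv ℝ (flatExtend g) p).smulRight (toSym (X p)) := by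
  rw [mDiffFieldAt_iff] at hX
  rw [mdifferentiableAt_iff_flatExtend] at hg
  rw [← flatExtend_coe g, ← flatField_coe, ← fderiv_smul hg hX]
  refine (flatExtend_eventuallyEq _ (fun q => ?_) p).fderiv_eq
  change _ = flatExtend g q • flatField X q
  rw [flatField_coe, flatExtend_coe]
  rfl

/-- The value of the Levi-Civita connection of the Bures-Wasserstein metric on `Y` at `p`. -/
noncomputable def bwCov (Y : SPDField n) (p : SPD n) : SymMat n →L[ℝ] SymMat n :=
  fderiv ℝ (flatField Y) p - christoffel (p : SymMat n) (toSym (Y p))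

theorem bwCov_add {X Y : SPDField n} {p : SPD n} (hX : MDiffFieldAt X p)
    (hY : MDiffFieldAt Y p) : bwCov (X + Y) p = bwCov X p + bwCov Y p := by
  have h : toSym ((X + Y) p) = toSym (X p) + toSym (Y p) := rfl
  rw [bwCov, fderiv_flatField_add hX hY, h, map_add, bwCov, bwCov]
  abel

theorem bwCov_smul {g : SPD n → ℝ} {X : SPDField n} {p : SPD n}
    (hX : MDiffFieldAt X p) (hg : MDifferentiableAt 𝓘(ℝ, SymMat n) 𝓘(ℝ, ℝ) g p) :
    bwCov (g • X) p =
      g p • bwCov X p + (fderiv ℝ (flatExtend g) p).smulRight (toSym (X p)) := by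
  have h : toSym ((g • X) p) = g p • toSym (X p) := rfl
  rw [bwCov, fderiv_flatField_smul hX hg, h, map_smul, bwCov]
  module

/-- The Levi-Civita connection of the Bures-Wasserstein metric. -/
noncomputable def bwConnection (n : ℕ) : SPDConnection n where
  toFun Y p := bwCov Y p
  isCovariantDerivativeOnUniv :=
    { add := fun hX hY _ => bwCov_add hX hY
      leibniz := fun {X g p} hX hg _ => by
        refine (bwCov_smul hX hg).trans ?_
        ext v
        exact congrArg (fun c : ℝ => g p • bwCov X p v + c • toSym (X p))
          (mvfderiv_eq_fderiv_flatExtend g p v).symm }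

theorem toSym_bwConnection (Y : SPDField n) (p : SPD n) (v : TangentSpace 𝓘(ℝ, SymMat n) p) :
    toSym (bwConnection n Y p v) = fderiv ℝ (flatField Y) p (toSym v) -
      christoffel (p : SymMat n) (toSym v) (toSym (Y p)) := by
  rw [christoffel_comm]
  rfl

theorem toSym_injective {p : SPD n} :
    Function.Injective (toSym : TangentSpace 𝓘(ℝ, SymMat n) p → SymMat n) := fun _ _ h => h

theorem toSym_sub {p : SPD n} (v w : TangentSpace 𝓘(ℝ, SymMat n) p) :
    toSym (v - w) = toSym v - toSym w := rfl

theorem inner_eq_bwForm {p : SPD n} (v w : TangentSpace 𝓘(ℝ, SymMat n) p) :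
    inner ℝ v w = bwForm (p : SymMat n) (toSym v) (toSym w) := rfl

theorem torsion_bwConnection : (bwConnection n).torsion = 0 := by
  rw [CovariantDerivative.torsion_eq_zero_iff]
  intro X Y p hX hY
  apply toSym_injective
  rw [toSym_sub, mlieBracket_eq hX hY, toSym_bwConnection, toSym_bwConnection,
    christoffel_comm _ (toSym (Y p))]
  abel

theorem isMetricCompatible_bwConnection : (bwConnection n).IsMetricCompatible := by
  rw [CovariantDerivative.isMetricCompatible_iff]
  intro p X U V hX hU hV
  have hU' := (mDiffFieldAt_iff U p).1 hU
  have hV' := (mDiffFieldAt_iff V p).1 hV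
  rw [mvfderiv_eq_fderiv_flatExtend]
  have h : flatExtend (fun q => inner ℝ (U q) (V q)) =ᶠ[𝓝 (p : SymMat n)]
      fun S => bwForm S (flatField U S) (flatField V S) :=
    flatExtend_eventuallyEq _ (fun q => by rw [flatField_coe, flatField_coe, inner_eq_bwForm]) p
  rw [h.fderiv_eq, fderiv_bwForm p.2 hU' hV']
  simp only [inner_eq_bwForm, toSym_bwConnection, flatField_coe]

theorem isLeviCivita_bwConnection (n : ℕ) : IsLeviCivita (bwConnection n) :=
  ⟨torsion_bwConnection, isMetricCompatible_bwConnection⟩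

/-- The constant vector field on `SPD(n)`. -/
def constField (v : SymMat n) : SPDField n := fun _ => v

theorem mDiffFieldAt_constField (v : SymMat n) (p : SPD n) : MDiffFieldAt (constField v) p := by
  rw [mDiffFieldAt_iff]
  exact (differentiableAt_const v).congr_of_eventuallyEq
    (flatExtend_eventuallyEq _ (g := fun _ => v) (fun _ => rfl) p)

/-- Three swaps of the symmetric pair alternating with three of the skew pair bring ⟨D u v, w⟩ back
to itself with sign -1. -/
theorem eq_zero_of_symm_of_skew {V : Type*} [NormedAddCommGroup V] [InnerProductSpace ℝ V]
    (D : V → V → V) (hs : ∀ u v, D u v = D v u)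
    (hk : ∀ u v w, inner ℝ (D u v) w + inner ℝ v (D u w) = 0) (u v : V) : D u v = 0 := by
  have h : ∀ u v w, inner ℝ (D u v) w = -inner ℝ (D u w) v := fun u v w => by
    rw [real_inner_comm v]
    linarith [hk u v w]
  have h2 : ∀ u v w, inner ℝ (D u v) w = 0 := fun u v w => by
    have e1 := h u v w
    have e2 := h w u v
    have e3 := h v w u
    rw [hs u w] at e1
    rw [hs w v] at e2
    rw [hs v u] at e3
    linarith
  exact inner_self_eq_zero.1 (h2 u v (D u v))

/-- Two Levi-Civita connections agree on differentiable vector fields. -/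
theorem IsLeviCivita.eq_bwConnection {cov : SPDConnection n} (h : IsLeviCivita cov)
    {Y : SPDField n} {p : SPD n} (hY : MDiffFieldAt Y p) : cov Y p = bwConnection n Y p := by
  have hT : ∀ cov : SPDConnection n, cov.torsion = 0 → ∀ U V : SPDField n, MDiffFieldAt U p →
      MDiffFieldAt V p →
      cov V p (U p) - cov U p (V p) = VectorField.mlieBracket 𝓘(ℝ, SymMat n) U V p :=
    fun cov h U V hU hV => (CovariantDerivative.torsion_eq_zero_iff (cov := cov)).1 h hU hV
  have hd : ∀ Z : SPDField n, MDiffFieldAt Z p →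
      cov.difference (bwConnection n) p (Z p) = cov Z p - bwConnection n Z p := fun Z hZ =>
    IsCovariantDerivativeOn.difference_apply _ _ (by trivial) hZ
  -- The difference of two connections is tensorial, so constant fields compute it on all tangent
  -- vectors.
  have hc : ∀ v : TangentSpace 𝓘(ℝ, SymMat n) p, cov.difference (bwConnection n) p v =
      cov (constField v) p - bwConnection n (constField v) p := fun v =>
    hd (constField v) (mDiffFieldAt_constField v p)
  have key := eq_zero_of_symm_of_skew
    (fun u v : TangentSpace 𝓘(ℝ, SymMat n) p => cov.difference (bwConnection n) p v u) ?_ ?_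
  · ext1 u
    have := key u (Y p)
    rw [hd Y hY] at this
    exact sub_eq_zero.1 this
  · intro u v
    have e1 := hT cov h.1 _ _ (mDiffFieldAt_constField u p) (mDiffFieldAt_constField v p)
    have e2 := hT _ torsion_bwConnection _ _ (mDiffFieldAt_constField u p) (mDiffFieldAt_constField v p)
    simp only [hc]
    rw [← e2] at e1
    exact sub_eq_sub_iff_sub_eq_sub.1 e1
  · intro u v w
    have e1 := h.2.mvfderiv_inner_eq (constField u) (mDiffFieldAt_constField v p)
      (mDiffFieldAt_constField w p)
    have e2 := isMetricCompatible_bwConnection.mvfderiv_inner_eq (constField u)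
      (mDiffFieldAt_constField v p) (mDiffFieldAt_constField w p)
    rw [e1] at e2
    simp only [hc, _root_.sub_apply, inner_sub_left, inner_sub_right]
    simp only [constField] at e2 ⊢
    linarith

end LeviCivita

/-! ### The curvature in terms of the Christoffel form. -/

section Curvature

variable {n : ℕ}

theorem IsLeviCivita.toSym_apply {cov : SPDConnection n} (h : IsLeviCivita cov)
    {Y : SPDField n} {p : SPD n} (hY : MDiffFieldAt Y p) (v : TangentSpace 𝓘(ℝ, SymMat n) p) :
    toSym (cov Y p v) = fderiv ℝ (flatField Y) p (toSym v) -
      christoffel (p : SymMat n) (toSym v) (toSym (Y p)) := by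
  rw [h.eq_bwConnection hY, toSym_bwConnection]

theorem SmoothField.mDiffFieldAt {X : SPDField n} (h : SmoothField X) (p : SPD n) :
    MDiffFieldAt X p :=
  (mDiffFieldAt_iff X p).2 ((h.contDiffAt p).differentiableAt (by simp))

theorem SmoothField.differentiableAt_fderiv {X : SPDField n} (h : SmoothField X) (p : SPD n) :
    DifferentiableAt ℝ (fderiv ℝ (flatField X)) p :=
  ((h.contDiffAt p).fderiv_right (m := 1) (by norm_cast)).differentiableAt one_ne_zero

/-- The equality has to hold near `p`, since the outer derivative of an iterated covariant
derivative acts on it. -/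
theorem IsLeviCivita.flatField_apply {cov : SPDConnection n} (h : IsLeviCivita cov)
    (Y : SPDField n) {Z : SPDField n} (hZ : SmoothField Z) (p : SPD n) :
    flatField (fun q => cov Z q (Y q)) =ᶠ[𝓝 (p : SymMat n)]
      fun S => fderiv ℝ (flatField Z) S (flatField Y S) -
        christoffel S (flatField Y S) (flatField Z S) :=
  flatExtend_eventuallyEq _ (fun q => by
    rw [h.toSym_apply (hZ.mDiffFieldAt q), flatField_coe, flatField_coe]) p

theorem IsLeviCivita.toSym_apply_apply {cov : SPDConnection n} (h : IsLeviCivita cov)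
    {Y Z : SPDField n} (hY : SmoothField Y) (hZ : SmoothField Z) (p : SPD n)
    (v : TangentSpace 𝓘(ℝ, SymMat n) p) :
    toSym (cov (fun q => cov Z q (Y q)) p v) =
      fderiv ℝ (fderiv ℝ (flatField Z)) p (toSym v) (toSym (Y p)) +
      fderiv ℝ (flatField Z) p (fderiv ℝ (flatField Y) p (toSym v)) -
      (christoffelDeriv p (toSym v) (toSym (Y p)) (toSym (Z p)) +
        christoffel (p : SymMat n) (fderiv ℝ (flatField Y) p (toSym v)) (toSym (Z p)) +
        christoffel (p : SymMat n) (toSym (Y p)) (fderiv ℝ (flatField Z) p (toSym v))) -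
      christoffel (p : SymMat n) (toSym v) (fderiv ℝ (flatField Z) p (toSym (Y p)) -
        christoffel (p : SymMat n) (toSym (Y p)) (toSym (Z p))) := by
  have hdY := (mDiffFieldAt_iff Y p).1 (hY.mDiffFieldAt p)
  have hdZ := (mDiffFieldAt_iff Z p).1 (hZ.mDiffFieldAt p)
  have h2 := hZ.differentiableAt_fderiv p
  have hW := h.flatField_apply Y hZ p
  have h3 := h2.clm_apply hdY
  have h4 := differentiableAt_christoffel p.2 hdY hdZ
  -- The formula for `cov` is available only on differentiable fields, so the inner covariant
  -- derivative must be shown to be one.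
  have hWd : MDiffFieldAt (fun q => cov Z q (Y q)) p :=
    (mDiffFieldAt_iff _ p).2 ((h3.sub h4).congr_of_eventuallyEq hW)
  rw [h.toSym_apply hWd, hW.fderiv_eq, fderiv_fun_sub h3 h4, _root_.sub_apply,
    fderiv_christoffel p.2 hdY hdZ, fderiv_clm_apply h2 hdY, h.toSym_apply (hZ.mDiffFieldAt p)]
  simp only [_root_.add_apply, ContinuousLinearMap.comp_apply, ContinuousLinearMap.flip_apply,
    flatField_coe]
  abel

theorem IsLeviCivita.toSym_curvature {cov : SPDConnection n} (h : IsLeviCivita cov)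
    {X Y Z : SPDField n} (hX : SmoothField X) (hY : SmoothField Y) (hZ : SmoothField Z)
    (p : SPD n) :
    toSym (curvature cov X Y Z p) =
      christoffelDeriv p (toSym (Y p)) (toSym (X p)) (toSym (Z p)) -
      christoffelDeriv p (toSym (X p)) (toSym (Y p)) (toSym (Z p)) +
      christoffel (p : SymMat n) (toSym (X p)) (christoffel (p : SymMat n) (toSym (Y p))
        (toSym (Z p))) -
      christoffel (p : SymMat n) (toSym (Y p)) (christoffel (p : SymMat n) (toSym (X p))
        (toSym (Z p))) := by
  rw [curvature, toSym_sub, toSym_sub, h.toSym_apply_apply hY hZ, h.toSym_apply_apply hX hZ,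
    h.toSym_apply (hZ.mDiffFieldAt p), mlieBracket_eq (hX.mDiffFieldAt p) (hY.mDiffFieldAt p)]
  -- The second-order terms cancel by symmetry of the second derivative, the first-order ones
  -- against the bracket term.
  have hs : fderiv ℝ (fderiv ℝ (flatField Z)) p (toSym (X p)) (toSym (Y p)) =
      fderiv ℝ (fderiv ℝ (flatField Z)) p (toSym (Y p)) (toSym (X p)) :=
    ((hZ.contDiffAt p).isSymmSndFDerivAt (by simp; norm_cast)) _ _
  simp only [map_sub, _root_.sub_apply, hs]
  abel

end Curvature

/-! ### The derivative of the Christoffel form as a matrix expression. -/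

section Algebra

variable {n : ℕ} {S : SymMat n}

/-- This is the product rule for U⁰ΣV⁰ + V⁰ΣU⁰: for fixed U the derivative of U⁰ is -(HU⁰ + U⁰H)⁰.
-/
theorem mat_christoffelDeriv (hS : S.mat.PosDef) (H U V : SymMat n) :
    (christoffelDeriv S H U V).mat =
      (symLift S U).mat * H.mat * (symLift S V).mat + (symLift S V).mat * H.mat * (symLift S U).mat -
      ((symLift S (lyapunov n H (symLift S U))).mat * S.mat * (symLift S V).mat +
        (symLift S V).mat * S.mat * (symLift S (lyapunov n H (symLift S U))).mat) -
      ((symLift S (lyapunov n H (symLift S V))).mat * S.mat * (symLift S U).mat +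
        (symLift S U).mat * S.mat * (symLift S (lyapunov n H (symLift S V))).mat) := by
  have ha := symLift_spec hS (lyapunov n H (symLift S U))
  have hb := symLift_spec hS (lyapunov n H (symLift S V))
  rw [christoffelDeriv]
  simp only [map_smul, map_add, map_sub, lyapunov_apply] at ha hb ⊢
  nth_rw 1 2 [symLift_spec hS U, symLift_spec hS V]
  generalize (symLift S (lyapunov n H (symLift S U))).mat = a at *
  generalize (symLift S (lyapunov n H (symLift S V))).mat = b at *
  generalize S.mat = s at *
  generalize H.mat = h at *
  generalize (symLift S U).mat = u at *
  generalize (symLift S V).mat = v at *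
  -- The Sylvester equations of `a` and `b` move an outer `s` to the middle of the word.
  have h1 : s * a * v = (h * u + u * h) * v - a * s * v := by rw [ha]; noncomm_ring
  have h2 : v * a * s = v * (h * u + u * h) - v * s * a := by rw [ha]; noncomm_ring
  have h3 : s * b * u = (h * v + v * h) * u - b * s * u := by rw [hb]; noncomm_ring
  have h4 : u * b * s = u * (h * v + v * h) - u * s * b := by rw [hb]; noncomm_ring
  simp only [mul_add, add_mul, ← mul_assoc, h1, h2, h3, h4]
  module

end Algebra

/-! ### The curvature numerator as a trace. -/

section Algebra

variable {n : ℕ} {S : SymMat n}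

/-- The Christoffel expression `∂_YΓ(X, Y) - ∂_XΓ(Y, Y) + Γ(X, Γ(Y, Y)) - Γ(Y, Γ(X, Y))` of the
curvature `R(X, Y) Y`. -/
noncomputable def christoffelCurvature (S X Y : SymMat n) : SymMat n :=
  christoffelDeriv S Y X Y - christoffelDeriv S X Y Y + christoffel S X (christoffel S Y Y) -
    christoffel S Y (christoffel S X Y)

/-- The solution `R` of `Σ R + R Σ = C Σ - Σ C` where `C = [X⁰, Y⁰]` (see `vertLift_spec`). -/
noncomputable def vertLift (S X Y : SymMat n) : SymMat n :=
  (2 : ℝ) • (symLift S (lyapunov n Y (symLift S X)) - symLift S (christoffel S X Y)) -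
    lyapunov n (symLift S X) (symLift S Y)

/-- By `symLift_christoffel`, `vertLift S X Y` is (YX⁰ + X⁰Y)⁰ - (XY⁰ + Y⁰X)⁰. Substituting X = ΣX⁰
+ X⁰Σ and the same for Y, the words with Σ in the middle cancel and the commutator remains. -/
theorem vertLift_spec (hS : S.mat.PosDef) (X Y : SymMat n) :
    S.mat * (vertLift S X Y).mat + (vertLift S X Y).mat * S.mat =
      ⁅(symLift S X).mat, (symLift S Y).mat⁆ * S.mat -
        S.mat * ⁅(symLift S X).mat, (symLift S Y).mat⁆ := by
  rw [← lyapunov_apply, vertLift]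
  simp only [map_sub, map_smul, lyapunov_symLift hS, christoffel_mat hS, lyapunov_apply]
  nth_rw 1 2 [symLift_spec hS Y]
  rw [Ring.lie_def]
  simp only [mul_add, add_mul, mul_sub, sub_mul, ← mul_assoc]
  module

theorem symLift_christoffel (hS : S.mat.PosDef) (X Y : SymMat n) :
    symLift S (lyapunov n X (symLift S Y)) + symLift S (lyapunov n Y (symLift S X)) =
      (2 : ℝ) • symLift S (christoffel S X Y) + lyapunov n (symLift S X) (symLift S Y) := by
  rw [christoffel_apply, map_smul, map_sub, map_add, symLift_lyapunov hS]
  module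

theorem mat_christoffelCurvature (hS : S.mat.PosDef) {X Y : SymMat n}
    {s x y r : Matrix (Fin n) (Fin n) ℝ} (hs : S.mat = s) (hx : (symLift S X).mat = x)
    (hy : (symLift S Y).mat = y) (hr : (vertLift S X Y).mat = r) :
    (christoffelCurvature S X Y).mat =
      x * Y.mat * y + y * Y.mat * x - (2 : ℝ) • (y * X.mat * y) +
      (1 / 2 : ℝ) • ((x * y + y * x) * s * y + y * s * (x * y + y * x)) -
      (3 / 2 : ℝ) • (r * s * y + y * s * r) - (y * y * s * x + x * s * (y * y)) := by
  have h1 := congrArg SymMat.mat (symLift_christoffel hS X Y)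
  have h2 := congrArg SymMat.mat (symLift_christoffel hS Y Y)
  rw [vertLift] at hr
  simp only [christoffelCurvature, map_sub, map_add, map_smul, mat_christoffelDeriv hS,
    christoffel_mat hS] at h1 h2 hr ⊢
  rw [lyapunov_apply (symLift S X)] at h1 hr
  rw [lyapunov_apply (symLift S Y) (symLift S Y)] at h2
  rw [hs, hx, hy] at *
  generalize (symLift S (lyapunov n X (symLift S Y))).mat = a at *
  generalize (symLift S (lyapunov n Y (symLift S X))).mat = b at *
  generalize (symLift S (lyapunov n Y (symLift S Y))).mat = c at *
  generalize (symLift S (christoffel S X Y)).mat = f at *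
  generalize (symLift S (christoffel S Y Y)).mat = e at *
  -- The sum a + b is known from `symLift_christoffel` and b - a = r. After substitution `e` and `f`
  -- cancel between the ∂Γ and ΓΓ terms, so `r` is the only Sylvester solution left.
  have hc : c = e + y * y := by linear_combination (norm := module) (1 / 2 : ℝ) • h2
  have hb : b = f + (1 / 2 : ℝ) • (x * y + y * x) + (1 / 2 : ℝ) • r := by
    linear_combination (norm := module) (1 / 2 : ℝ) • hr
  have ha : a = f + (1 / 2 : ℝ) • (x * y + y * x) - (1 / 2 : ℝ) • r := by
    linear_combination (norm := module) h1 - (1 / 2 : ℝ) • hr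
  rw [ha, hb, hc]
  simp only [mul_add, add_mul, mul_sub, sub_mul, ← mul_assoc, smul_mul_assoc, mul_smul_comm]
  module

theorem trace_curvature_word {s x y r : Matrix (Fin n) (Fin n) ℝ} (hs : sᵀ = s) (hx : xᵀ = x)
    (hy : yᵀ = y) (hr : s * r + r * s = ⁅x, y⁆ * s - s * ⁅x, y⁆) :
    (x * (x * (s * y + y * s) * y + y * (s * y + y * s) * x -
      (2 : ℝ) • (y * (s * x + x * s) * y) +
      (1 / 2 : ℝ) • ((x * y + y * x) * s * y + y * s * (x * y + y * x)) -
      (3 / 2 : ℝ) • (r * s * y + y * s * r) - (y * y * s * x + x * s * (y * y)))).trace =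
    -(3 / 2 : ℝ) * (s * (⁅x, y⁆ * ⁅x, y⁆)).trace -
      (3 / 4 : ℝ) * (r * (⁅x, y⁆ * s - s * ⁅x, y⁆)).trace := by
  -- The cofactor of `r` is syx + xys. It splits into half the anticommutator of s with xy + yx,
  -- which `hr` frees of `r` by duality under the trace, and half the right side of `hr`.
  have e1 : (x * (r * s * y + y * s * r)).trace =
      (1 / 2 : ℝ) * ((⁅x, y⁆ * s - s * ⁅x, y⁆) * (x * y + y * x)).trace +
      (1 / 2 : ℝ) * (r * (⁅x, y⁆ * s - s * ⁅x, y⁆)).trace := by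
    have h1 : (x * (r * s * y + y * s * r)).trace = (r * (s * y * x + x * y * s)).trace := by
      rw [mul_add, mul_add, Matrix.trace_add, Matrix.trace_add, Matrix.trace_mul_comm x,
        ← mul_assoc x, Matrix.trace_mul_comm _ r]
      simp only [← mul_assoc]
    have h2 : s * y * x + x * y * s = (1 / 2 : ℝ) • (s * (x * y + y * x) + (x * y + y * x) * s) +
        (1 / 2 : ℝ) • (⁅x, y⁆ * s - s * ⁅x, y⁆) := by
      rw [Ring.lie_def]
      simp only [mul_add, add_mul, mul_sub, sub_mul, ← mul_assoc]
      module
    have h3 : (r * (s * (x * y + y * x) + (x * y + y * x) * s)).trace =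
        ((⁅x, y⁆ * s - s * ⁅x, y⁆) * (x * y + y * x)).trace := by
      rw [← hr, mul_add r, add_mul (s * r), Matrix.trace_add, Matrix.trace_add, mul_assoc s,
        Matrix.trace_mul_comm s, add_comm]
      simp only [mul_assoc]
    rw [h1, h2, mul_add, mul_smul_comm, mul_smul_comm, Matrix.trace_add, Matrix.trace_smul,
      Matrix.trace_smul, h3, smul_eq_mul, smul_eq_mul]
  -- Cyclicity brings `s` to the front of each trace word.
  have c2 : ∀ p q u v : Matrix (Fin n) (Fin n) ℝ,
      (p * q * s * u * v).trace = (s * u * v * p * q).trace := fun p q u v => by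
    rw [mul_assoc _ p q, Matrix.trace_mul_comm _ (p * q)]; simp only [mul_assoc]
  have c3 : ∀ p q u v : Matrix (Fin n) (Fin n) ℝ,
      (p * q * u * s * v).trace = (s * v * p * q * u).trace := fun p q u v => by
    rw [mul_assoc _ s v, Matrix.trace_mul_comm _ (s * v)]; simp only [mul_assoc]
  have c4 : ∀ p q u v : Matrix (Fin n) (Fin n) ℝ,
      (p * q * u * v * s).trace = (s * p * q * u * v).trace := fun p q u v => by
    rw [Matrix.trace_mul_comm _ s]; simp only [mul_assoc]
  -- Transposition reverses words in symmetric letters, which identifies the remaining pairs.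
  have r1 : (s * y * x * y * x).trace = (s * x * y * x * y).trace := by
    rw [← Matrix.trace_transpose]
    simp only [Matrix.transpose_mul, hs, hx, hy, ← mul_assoc, c4]
  have r2 : (s * y * y * x * x).trace = (s * x * x * y * y).trace := by
    rw [← Matrix.trace_transpose]
    simp only [Matrix.transpose_mul, hs, hx, hy, ← mul_assoc, c4]
  rw [mul_sub x _ (y * y * s * x + x * s * (y * y)), mul_sub x _ ((3 / 2 : ℝ) • _), mul_smul_comm,
    Matrix.trace_sub, Matrix.trace_sub, Matrix.trace_smul, e1, Ring.lie_def]
  simp only [mul_add, add_mul, mul_sub, sub_mul, ← mul_assoc, Matrix.trace_add, Matrix.trace_sub,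
    mul_smul_comm, Matrix.trace_smul, smul_eq_mul, c2, c3, r1, r2]
  ring

theorem bwForm_christoffelCurvature (hS : S.mat.PosDef) (X Y : SymMat n) :
    bwForm S (christoffelCurvature S X Y) X =
      -(3 / 4 : ℝ) * (S.mat * (⁅(symLift S X).mat, (symLift S Y).mat⁆ *
        ⁅(symLift S X).mat, (symLift S Y).mat⁆)).trace -
      (3 / 8 : ℝ) * ((vertLift S X Y).mat * (⁅(symLift S X).mat, (symLift S Y).mat⁆ * S.mat -
        S.mat * ⁅(symLift S X).mat, (symLift S Y).mat⁆)).trace := by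
  rw [bwForm_symm hS, bwForm_apply, mat_christoffelCurvature hS rfl rfl rfl rfl]
  have h := trace_curvature_word S.transpose_mat (symLift S X).transpose_mat
    (symLift S Y).transpose_mat (vertLift_spec hS X Y)
  rw [← symLift_spec hS X, ← symLift_spec hS Y] at h
  rw [h]
  ring

end Algebra

/-! ### Evaluation in an eigenbasis, and Cauchy-Schwarz. -/

section Spectral

variable {n : ℕ}

theorem trace_conj_orthogonal {P : Matrix (Fin n) (Fin n) ℝ}
    (hP : P ∈ Matrix.orthogonalGroup (Fin n) ℝ) (A : Matrix (Fin n) (Fin n) ℝ) :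
    (Pᵀ * A * P).trace = A.trace := by
  rw [Matrix.trace_mul_comm, ← mul_assoc, (Matrix.mem_orthogonalGroup_iff (Fin n) ℝ).1 hP, one_mul]

theorem conj_mul_orthogonal {P : Matrix (Fin n) (Fin n) ℝ}
    (hP : P ∈ Matrix.orthogonalGroup (Fin n) ℝ) (A B : Matrix (Fin n) (Fin n) ℝ) :
    Pᵀ * (A * B) * P = (Pᵀ * A * P) * (Pᵀ * B * P) := by
  have h : P * Pᵀ = 1 := (Matrix.mem_orthogonalGroup_iff (Fin n) ℝ).1 hP
  calc Pᵀ * (A * B) * P = Pᵀ * A * 1 * B * P := by simp only [mul_one, mul_assoc]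
    _ = _ := by rw [← h]; simp only [mul_assoc]

theorem posDef_diagonal_of_eq {A P : Matrix (Fin n) (Fin n) ℝ} (hA : A.PosDef)
    (hP : P ∈ Matrix.orthogonalGroup (Fin n) ℝ) {d : Fin n → ℝ}
    (h : A = P * Matrix.diagonal d * Pᵀ) :
    Pᵀ * A * P = Matrix.diagonal d ∧ ∀ i, 0 < d i := by
  have hP1 : Pᵀ * P = 1 := (Matrix.mem_orthogonalGroup_iff' (Fin n) ℝ).1 hP
  have hP2 : P * Pᵀ = 1 := (Matrix.mem_orthogonalGroup_iff (Fin n) ℝ).1 hP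
  have hD : Pᵀ * A * P = Matrix.diagonal d := by
    rw [h]
    calc Pᵀ * (P * Matrix.diagonal d * Pᵀ) * P
        = (Pᵀ * P) * Matrix.diagonal d * (Pᵀ * P) := by simp only [mul_assoc]
      _ = _ := by simp [hP1]
  have h1 : (Pᵀ * A * P).PosDef := by
    have hu : IsUnit P := ⟨⟨P, Pᵀ, hP2, hP1⟩, rfl⟩
    simpa [Matrix.star_eq_conjTranspose, Matrix.conjTranspose_eq_transpose_of_trivial] using
      (Matrix.IsUnit.posDef_star_left_conjugate_iff hu).2 hA
  rw [hD] at h1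
  exact ⟨hD, Matrix.posDef_diagonal_iff.1 h1⟩

theorem trace_diagonal_formula {d : Fin n → ℝ} (hd : ∀ i, 0 < d i)
    {C R : Matrix (Fin n) (Fin n) ℝ} (hC : Cᵀ = -C)
    (hR : Matrix.diagonal d * R + R * Matrix.diagonal d =
      C * Matrix.diagonal d - Matrix.diagonal d * C) :
    -(3 / 4 : ℝ) * (Matrix.diagonal d * (C * C)).trace -
      (3 / 8 : ℝ) * (R * (C * Matrix.diagonal d - Matrix.diagonal d * C)).trace =
    (3 / 2 : ℝ) * ∑ i, ∑ j, d i * d j / (d i + d j) * C i j ^ 2 := by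
  have hC' : ∀ i j, C j i = -C i j := fun i j => congrFun (congrFun hC i) j
  have h1 : (Matrix.diagonal d * (C * C)).trace = -∑ i, ∑ j, d i * C i j ^ 2 := by
    simp only [Matrix.trace, Matrix.diag_apply, Matrix.diagonal_mul]
    simp only [Matrix.mul_apply, Finset.mul_sum, ← Finset.sum_neg_distrib]
    refine Finset.sum_congr rfl fun i _ => Finset.sum_congr rfl fun j _ => ?_
    rw [hC' i j]
    ring
  -- Since C_ij² is symmetric in i and j, the weight d_i may be averaged with d_j.
  have h2 : ∑ i, ∑ j, d i * C i j ^ 2 = ∑ i, ∑ j, (d i + d j) / 2 * C i j ^ 2 := by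
    have h3 : ∑ i, ∑ j, d i * C i j ^ 2 = ∑ i, ∑ j, d j * C i j ^ 2 := by
      rw [Finset.sum_comm]
      refine Finset.sum_congr rfl fun i _ => Finset.sum_congr rfl fun j _ => ?_
      rw [hC' i j, neg_sq]
    have h4 : ∑ i, ∑ j, (d i + d j) / 2 * C i j ^ 2 =
        (1 / 2) * (∑ i, ∑ j, d i * C i j ^ 2 + ∑ i, ∑ j, d j * C i j ^ 2) := by
      simp only [← Finset.sum_add_distrib, Finset.mul_sum]
      refine Finset.sum_congr rfl fun i _ => Finset.sum_congr rfl fun j _ => ?_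
      ring
    rw [h4, ← h3]
    ring
  have hR' : ∀ i j, R i j = (d j - d i) / (d i + d j) * C i j := fun i j => by
    have h := congrFun (congrFun hR i) j
    simp only [Matrix.add_apply, Matrix.sub_apply, Matrix.diagonal_mul, Matrix.mul_diagonal] at h
    have := (add_pos (hd i) (hd j)).ne'
    field_simp
    linarith
  have h5 : (R * (C * Matrix.diagonal d - Matrix.diagonal d * C)).trace =
      ∑ i, ∑ j, (d j - d i) ^ 2 / (d i + d j) * C i j ^ 2 := by
    simp only [Matrix.trace, Matrix.diag_apply, Matrix.mul_apply (M := R), Matrix.sub_apply,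
      Matrix.diagonal_mul, Matrix.mul_diagonal]
    refine Finset.sum_congr rfl fun i _ => Finset.sum_congr rfl fun j _ => ?_
    rw [hC' i j, hR' i j]
    ring
  rw [h1, h2, h5]
  simp only [← Finset.sum_neg_distrib, Finset.mul_sum, ← Finset.sum_sub_distrib]
  refine Finset.sum_congr rfl fun i _ => Finset.sum_congr rfl fun j _ => ?_
  have := (add_pos (hd i) (hd j)).ne'
  -- What remains is (d_i + d_j)² - (d_j - d_i)² = 4 d_i d_j.
  field_simp
  ring

theorem bwForm_christoffelCurvature_spectral {S : SymMat n} (hS : S.mat.PosDef) (X Y : SymMat n)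
    {P : Matrix (Fin n) (Fin n) ℝ} (hP : P ∈ Matrix.orthogonalGroup (Fin n) ℝ) {d : Fin n → ℝ}
    (h : S.mat = P * Matrix.diagonal d * Pᵀ) :
    bwForm S (christoffelCurvature S X Y) X = (3 / 2 : ℝ) * ∑ i, ∑ j, d i * d j / (d i + d j) *
      ⁅Pᵀ * (symLift S X).mat * P, Pᵀ * (symLift S Y).mat * P⁆ i j ^ 2 := by
  obtain ⟨hD, hd⟩ := posDef_diagonal_of_eq hS hP h
  have hconj : ∀ A B, Pᵀ * ⁅A, B⁆ * P = ⁅Pᵀ * A * P, Pᵀ * B * P⁆ := fun A B => by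
    rw [Ring.lie_def, Ring.lie_def, mul_sub, sub_mul, conj_mul_orthogonal hP,
      conj_mul_orthogonal hP]
  have hR := congrArg (fun M => Pᵀ * M * P) (vertLift_spec hS X Y)
  have hT : ∀ Z : SymMat n, (Pᵀ * Z.mat * P)ᵀ = Pᵀ * Z.mat * P := fun Z => by
    simp only [Matrix.transpose_mul, SymMat.transpose_mat, Matrix.transpose_transpose, mul_assoc]
  simp only [mul_add, add_mul, mul_sub, sub_mul, conj_mul_orthogonal hP, hD, hconj] at hR
  rw [bwForm_christoffelCurvature hS, ← trace_conj_orthogonal hP (S.mat * _),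
    ← trace_conj_orthogonal hP ((vertLift S X Y).mat * _), ← trace_diagonal_formula hd ?_ hR]
  · simp only [mul_sub, sub_mul, conj_mul_orthogonal hP, hD, hconj]
  · rw [Ring.lie_def, Matrix.transpose_sub, Matrix.transpose_mul (Pᵀ * (symLift S X).mat * P),
      Matrix.transpose_mul (Pᵀ * (symLift S Y).mat * P), hT, hT, neg_sub]

theorem exists_orthogonal_diagonalization {A : Matrix (Fin n) (Fin n) ℝ} (hA : A.IsHermitian) :
    ∃ P ∈ Matrix.orthogonalGroup (Fin n) ℝ, ∃ d : Fin n → ℝ, A = P * Matrix.diagonal d * Pᵀ := by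
  refine ⟨hA.eigenvectorUnitary, hA.eigenvectorUnitary.2, hA.eigenvalues, ?_⟩
  have h := hA.spectral_theorem
  rw [Unitary.conjStarAlgAut_apply] at h
  exact h

/-- Cauchy-Schwarz, from g(Z, Z) ≥ 0 with Z = g(X, X)Y - g(X, Y)X; it controls the denominator of
the sectional curvature. -/
theorem bwForm_sq_le {S : SymMat n} (hS : S.mat.PosDef) (X Y : SymMat n) :
    bwForm S X Y ^ 2 ≤ bwForm S X X * bwForm S Y Y := by
  have hnn : ∀ Z, 0 ≤ bwForm S Z Z := fun Z => by
    by_cases hZ : Z = 0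
    · simp [hZ]
    · exact (bwForm_pos hS Z hZ).le
  by_cases hX : X = 0
  · simp [hX]
  have hpos := bwForm_pos hS X hX
  have h := hnn (bwForm S X X • Y - bwForm S X Y • X)
  simp only [map_sub, map_smul, _root_.sub_apply, _root_.smul_apply, smul_eq_mul,
    bwForm_symm hS Y X] at h
  have h2 : 0 ≤ bwForm S X X * (bwForm S X X * bwForm S Y Y - bwForm S X Y ^ 2) := by
    linarith
  exact sub_nonneg.1 (nonneg_of_mul_nonneg_right h2 hpos)

end Spectral

/-! ### The curvature formula and its sign. -/

theorem IsLeviCivita.riemann_eq {n : ℕ} {cov : SPDConnection n} (h : IsLeviCivita cov)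
    {X Y : SPDField n} (hX : SmoothField X) (hY : SmoothField Y) (p : SPD n) :
    riemann cov X Y X Y p =
      bwForm (p : SymMat n) (christoffelCurvature p (toSym (X p)) (toSym (Y p))) (toSym (X p)) := by
  rw [christoffelCurvature, ← h.toSym_curvature hX hY hY p]
  rfl

theorem mainTheorem9 (n : ℕ) :
    (∃ cov : SPDConnection n, IsLeviCivita cov) ∧
    ∀ cov : SPDConnection n, IsLeviCivita cov →
      (∀ (X Y : SPDField n) (p : SPD n), MDiffFieldAt Y p →
        (toSym (cov Y p (X p))).mat = (flatDeriv X Y p).mat -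
          (lift0 (X p) * p.1.mat * lift0 (Y p) + lift0 (Y p) * p.1.mat * lift0 (X p))) ∧
      (∀ X Y : SPDField n, SmoothField X → SmoothField Y → ∀ p : SPD n,
        (∀ P ∈ Matrix.orthogonalGroup (Fin n) ℝ, ∀ d : Fin n → ℝ,
          p.1.mat = P * Matrix.diagonal d * Pᵀ →
          riemann cov X Y X Y p = (3 / 2 : ℝ) * ∑ i, ∑ j, d i * d j / (d i + d j) *
            ⁅Pᵀ * lift0 (X p) * P, Pᵀ * lift0 (Y p) * P⁆ i j ^ 2) ∧
        0 ≤ riemann cov X Y X Y p ∧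
        (LinearIndependent ℝ ![X p, Y p] → 0 ≤ sectionalCurvature cov X Y p)) := by
  refine ⟨⟨bwConnection n, isLeviCivita_bwConnection n⟩, fun cov h => ⟨fun X Y p hY => ?_,
    fun X Y hX hY p => ?_⟩⟩
  · rw [h.toSym_apply hY, map_sub, christoffel_mat p.2, flatDeriv_eq]
    rfl
  have hformula : ∀ P ∈ Matrix.orthogonalGroup (Fin n) ℝ, ∀ d : Fin n → ℝ,
      p.1.mat = P * Matrix.diagonal d * Pᵀ →
      riemann cov X Y X Y p = (3 / 2 : ℝ) * ∑ i, ∑ j, d i * d j / (d i + d j) *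
        ⁅Pᵀ * lift0 (X p) * P, Pᵀ * lift0 (Y p) * P⁆ i j ^ 2 := fun P hP d hd => by
    rw [h.riemann_eq hX hY, bwForm_christoffelCurvature_spectral p.2 _ _ hP hd]
    rfl
  have hnonneg : 0 ≤ riemann cov X Y X Y p := by
    -- A single diagonalization, from the spectral theorem, is enough to read off the sign.
    obtain ⟨P, hP, d, hd⟩ := exists_orthogonal_diagonalization p.2.isHermitian
    have hpos := (posDef_diagonal_of_eq p.2 hP hd).2
    rw [hformula P hP d hd]
    refine mul_nonneg (by norm_num) (Finset.sum_nonneg fun i _ => Finset.sum_nonneg fun j _ => ?_)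
    have := hpos i
    have := hpos j
    positivity
  refine ⟨hformula, hnonneg, fun _ => div_nonneg hnonneg (sub_nonneg.2 ?_)⟩
  exact bwForm_sq_le p.2 (toSym (X p)) (toSym (Y p))
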